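/- Let $S=\mathbb C[x,y,z]$, let $C:f=0$ be a reduced curve of degree $d\ge 3$ in $\mathbb P^2$ over $\mathbb C$ (so $f\in S$ is homogeneous of degree $d$ and square-free), let $J_f=(f_x,f_y,f_z)$ be the Jacobian ideal, $M(f)=S/J_f$ the Milnor algebra and $$D_0(f)=\{(a,b,c)\in S^3 : af_x+bf_y+cf_z=0\}$$ the graded module of Jacobian syzygies. Let $\tau(C)$ be the total Tjurina number of $C$, that is, the degree of $J_f$ (the constant value of the Hilbert polynomial of $M(f)$). The curve $C$ is said to be of type $(d,r,m)$ if $D_0(f)$ is minimally generated by $m$ homogeneous syzygies, all of the same degree $r$. Put $\Delta m=(2r-d+3)-m$. Assume that $C$ is of type $(d,r,m)$ with $m>3$ and $\Delta m=3$. Then $M(f)$ has a minimal graded free resolution of the form $$0\to \bigoplus_{j=1}^{m-2}S(-e_j)\to S(1-d-r)^m\to S^3(1-d)\to S,\qquad e_1\le\dots\le e_{m-2},$$ and if the integers $\epsilon_j$ are defined by $e_j=d+r-1+\epsilon_j$ for $1\le j\le m-2$, then one of the following three cases holds: 1. $\epsilon_{m-2}=4$, $\epsilon_j=1$ for $1\le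 j\le m-3$, and $\tau(C)=\frac{d(d-1)}2-6+r(d-r-2)$; 2. $\epsilon_{m-2}=3$, $\epsilon_{m-3}=2$, $\epsilon_j=1$ for $1\le j\le m-4$, and $\tau(C)=\frac{d(d-1)}2-4+r(d-r-2)$; 3. $m\ge 5$, $\epsilon_{m-2}=\epsilon_{m-3}=\epsilon_{m-4}=2$, $\epsilon_j=1$ for $1\le j\le m-5$, and $\tau(C)=\frac{d(d-1)}2-3+r(d-r-2)$. -/

import Mathlib

open Filter

namespace JacobianSyzygies

/-- The polynomial ring `S = ℂ[x, y, z]`. -/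
abbrev S : Type := MvPolynomial (Fin 3) ℂ

/-- The Jacobian ideal `J_f`, generated by the three partial derivatives of `f`. -/
noncomputable def jacobianIdeal (f : S) : Ideal S :=
  Ideal.span (Set.range fun i : Fin 3 => MvPolynomial.pderiv i f)

/-- The map `S³ → S`, `(a, b, c) ↦ a f_x + b f_y + c f_z`. -/
noncomputable def gradientMap (f : S) : (Fin 3 → S) →ₗ[S] S :=
  Fintype.linearCombination S fun i : Fin 3 => MvPolynomial.pderiv i f

/-- The module `D₀(f)` of Jacobian syzygies: all `(a, b, c)` with `a f_x + b f_y + c f_z = 0`. -/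
noncomputable def D0 (f : S) : Submodule S (Fin 3 → S) :=
  LinearMap.ker (gradientMap f)

/-- `ρ₁, …, ρ_m` is a minimal set of homogeneous generators of `D₀(f)`, with
`deg ρ_j = δ_j` and `δ₁ ≤ ⋯ ≤ δ_m`. -/
structure IsMinimalGenerators (f : S) {m : ℕ} (δ : Fin m → ℕ) (ρ : Fin m → Fin 3 → S) :
    Prop where
  monotone : Monotone δ
  homogeneous : ∀ j i, (ρ j i).IsHomogeneous (δ j)
  span_eq : Submodule.span S (Set.range ρ) = D0 f
  irredundant : ∀ j, ρ j ∉ Submodule.span S (ρ '' {j}ᶜ)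

/-- `C : f = 0` is a reduced plane curve of degree `d ≥ 3` which is of type `(d, r, m)`:
the module `D₀(f)` is minimally generated by `m` homogeneous syzygies, all of degree `r`. -/
def IsCurveOfType (f : S) (d r m : ℕ) : Prop :=
  3 ≤ d ∧ f.IsHomogeneous d ∧ Squarefree f ∧
    ∃ ρ : Fin m → Fin 3 → S, IsMinimalGenerators f (fun _ => r) ρ

/-- `Δm = m(d, r)_max - m`, where `m(d, r)_max = 2 r - d + 3`. -/
def deltaM (d r m : ℕ) : ℤ :=
  (2 * (r : ℤ) - d + 3) - m

/-- The dimension of the degree `k` component `M(f)_k` of the Milnor algebra `M(f) = S / J_f`,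
that is, of the image of `S_k` in `S / J_f`. -/
noncomputable def milnorDim (f : S) (k : ℕ) : ℕ :=
  Module.finrank ℂ ((MvPolynomial.homogeneousSubmodule (Fin 3) ℂ k).map
    (Ideal.Quotient.mkₐ ℂ (jacobianIdeal f)).toLinearMap)

/-- `τ` is the total Tjurina number of the reduced curve `C : f = 0`, that is, the degree of
the Jacobian ideal `J_f`: the Hilbert polynomial of `S / J_f` is the constant `τ`. -/
def IsTotalTjurina (f : S) (τ : ℕ) : Prop :=
  ∀ᶠ k in atTop, milnorDim f k = τ

/-- `p` is homogeneous of degree `k ∈ ℤ` (so `p = 0` if `k < 0`). -/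
def IsHomogeneousInt (p : S) (k : ℤ) : Prop :=
  ∀ u : Fin 3 →₀ ℕ, p.coeff u ≠ 0 → (u.degree : ℤ) = k

/-- The matrix `A` defines a morphism of graded modules `⨁ᵢ S(-aᵢ) → ⨁ⱼ S(-bⱼ)`. -/
def IsGradedMatrix {ι κ : Type} (a : ι → ℤ) (b : κ → ℤ) (A : Matrix κ ι S) : Prop :=
  ∀ j i, IsHomogeneousInt (A j i) (a i - b j)

/-- The matrices `A`, `B` and the gradient of `f` form a minimal graded free resolution
`0 → ⨁ᵢ S(-eᵢ) → ⨁ⱼ S(1 - d - δⱼ) → S³(1 - d) → S` of the Milnor algebra `M(f) = S / J_f`,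
with `e₁ ≤ ⋯ ≤ eₙ` and `δ₁ ≤ ⋯ ≤ δ_m`.  Minimality means that no entry of
`A` and `B` has a constant term (the same is automatic for the partial derivatives of `f`
when `f` is homogeneous of degree `d ≥ 3`). -/
structure IsMinimalResolution (f : S) (d : ℕ) {m n : ℕ} (δ : Fin m → ℕ) (e : Fin n → ℤ)
    (A : Matrix (Fin 3) (Fin m) S) (B : Matrix (Fin m) (Fin n) S) : Prop where
  monotone_δ : Monotone δ
  monotone_e : Monotone e
  graded_A : IsGradedMatrix (fun j => (d : ℤ) - 1 + δ j) (fun _ => (d : ℤ) - 1) A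
  graded_B : IsGradedMatrix e (fun j => (d : ℤ) - 1 + δ j) B
  exact_gradient : Function.Exact A.mulVecLin (gradientMap f)
  exact_A : Function.Exact B.mulVecLin A.mulVecLin
  injective_B : Function.Injective B.mulVecLin
  minimal_A : ∀ i j, MvPolynomial.constantCoeff (A i j) = 0
  minimal_B : ∀ i j, MvPolynomial.constantCoeff (B i j) = 0

/-- The integers `ε_j` defined by `e_j = d + d_{j+2} - 1 + ε_j` for `j = 1, …, m - 2`
(in the code `j` runs from `0` to `m - 3`, so `ε_j` is the value at `j - 1`). -/
def epsilon (d : ℕ) {m : ℕ} (δ : Fin m → ℕ) (e : Fin (m - 2) → ℤ) (j : Fin (m - 2)) : ℤ :=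
  e j - ((d : ℤ) + δ ⟨j.val + 2, by omega⟩ - 1)

end JacobianSyzygies

/-! The generating syzygies form a matrix `A` whose columns span `D0 f`. Its kernel is a second
syzygy module, so x, y, z is a regular sequence on it (`hasRegularVariables_ker`), and a graded
Nakayama argument makes it free on a homogeneous basis (`exists_homogeneous_basis`). That basis
supplies `B`, and irredundancy of the generators makes the resolution minimal.

The resolution expresses `milnorDim f k`, for large `k`, as a quadratic polynomial in `k`
(`milnorDim_eq_of_resolution`). This polynomial is bounded (`milnorDim_bounded`): as f is
square-free, no prime divides all three partials, so the Jacobian ideal contains a complete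
intersection of two forms of degree d - 1. Hence its quadratic and linear coefficients vanish. The
first fixes the rank m - 2 of the last module, the second fixes the sum of the e_j, and the constant
term is τ, expressed through the sum of the e_j² (`resolution_numerics`).

Put x_j = ε_j - 1. Minimality gives x_j ≥ 0, and the sum formula says that the x_j add up to Δm = 3.
The three cases are the partitions 3, 2+1, 1+1+1, whose sums of squares 9, 5, 3 lower τ by (9+3)/2,
(5+3)/2, (3+3)/2. -/

namespace JacobianSyzygies

/-! ### Homogeneous components and graded matrices -/

/-- The homogeneous component of integer degree `n`; it is zero for `n < 0`. -/
noncomputable def intComponent (n : ℤ) : S →ₗ[ℂ] S :=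
  if 0 ≤ n then MvPolynomial.homogeneousComponent n.toNat else 0

theorem coeff_intComponent (n : ℤ) (p : S) (u : Fin 3 →₀ ℕ) :
    (intComponent n p).coeff u = if (u.degree : ℤ) = n then p.coeff u else 0 := by
  unfold intComponent
  split_ifs with h0 h1 h1
  · rw [MvPolynomial.coeff_homogeneousComponent, if_pos (by omega)]
  · rw [MvPolynomial.coeff_homogeneousComponent, if_neg (by omega)]
  · omega
  · simp

theorem isHomogeneousInt_intComponent (n : ℤ) (p : S) :
    IsHomogeneousInt (intComponent n p) n := by
  intro u hu
  by_contra h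
  exact hu (by rw [coeff_intComponent, if_neg h])

theorem IsHomogeneousInt.intComponent_eq {p : S} {n : ℤ} (hp : IsHomogeneousInt p n) :
    intComponent n p = p := by
  ext u
  rw [coeff_intComponent]
  split_ifs with h
  · rfl
  · by_contra h'
    exact h (hp u (Ne.symm h'))

/-- Only the monomials of degree `a` in `p` contribute. This is why multiplication by a graded
matrix commutes with the projections to graded pieces. -/
theorem intComponent_mul {p : S} {a : ℤ} (hp : IsHomogeneousInt p a) (n : ℤ) (q : S) :
    intComponent n (p * q) = p * intComponent (n - a) q := by
  ext u
  rw [coeff_intComponent, MvPolynomial.coeff_mul, MvPolynomial.coeff_mul,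
    ← mul_boole, Finset.sum_mul]
  refine Finset.sum_congr rfl fun v hv => ?_
  rw [coeff_intComponent]
  by_cases h : p.coeff v.1 = 0
  · simp [h]
  · have h1 := hp _ h
    have h2 : u.degree = v.1.degree + v.2.degree := by
      rw [← Finset.HasAntidiagonal.mem_antidiagonal.mp hv, map_add]
    have : ((u.degree : ℤ) = n) ↔ ((v.2.degree : ℤ) = n - a) := by omega
    simp [this]

theorem isHomogeneousInt_natCast_iff {p : S} {n : ℕ} :
    IsHomogeneousInt p n ↔ p.IsHomogeneous n := by
  constructor
  · intro h u hu
    have := h u hu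
    rw [Finsupp.degree_eq_weight_one] at this
    exact_mod_cast this
  · intro h u hu
    have := h hu
    rw [Finsupp.degree_eq_weight_one]
    exact_mod_cast this

theorem isHomogeneousInt_zero (n : ℤ) : IsHomogeneousInt 0 n := fun u hu => by simp at hu

theorem IsHomogeneousInt.add {p q : S} {n : ℤ} (hp : IsHomogeneousInt p n)
    (hq : IsHomogeneousInt q n) : IsHomogeneousInt (p + q) n := by
  rw [← hp.intComponent_eq, ← hq.intComponent_eq, ← map_add]
  exact isHomogeneousInt_intComponent _ _

theorem IsHomogeneousInt.neg {p : S} {n : ℤ} (hp : IsHomogeneousInt p n) :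
    IsHomogeneousInt (-p) n := by
  rw [← hp.intComponent_eq, ← map_neg]
  exact isHomogeneousInt_intComponent _ _

theorem IsHomogeneousInt.mul {p q : S} {a b : ℤ} (hp : IsHomogeneousInt p a)
    (hq : IsHomogeneousInt q b) : IsHomogeneousInt (p * q) (a + b) := by
  have : intComponent (a + b) (p * q) = p * q := by
    rw [intComponent_mul hp, add_sub_cancel_left, hq.intComponent_eq]
  rw [← this]
  exact isHomogeneousInt_intComponent _ _

theorem IsHomogeneousInt.eq_zero_of_neg {p : S} {n : ℤ} (hp : IsHomogeneousInt p n) (hn : n < 0) :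
    p = 0 := by
  ext u
  by_contra h
  have := hp u h
  omega

theorem IsHomogeneousInt.eq_C {p : S} (hp : IsHomogeneousInt p 0) :
    p = MvPolynomial.C (MvPolynomial.constantCoeff p) := by
  have h : p.IsHomogeneous 0 := isHomogeneousInt_natCast_iff.mp (by simpa using hp)
  rw [← MvPolynomial.totalDegree_zero_iff_isHomogeneous,
    MvPolynomial.totalDegree_eq_zero_iff_eq_C] at h
  exact h

theorem isHomogeneousInt_X (i : Fin 3) : IsHomogeneousInt (MvPolynomial.X i) 1 := by
  exact_mod_cast isHomogeneousInt_natCast_iff.mpr (MvPolynomial.isHomogeneous_X ℂ i)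

theorem sum_intComponent (p : S) :
    ∑ k ∈ Finset.range (p.totalDegree + 1), intComponent k p = p := by
  conv_rhs => rw [← MvPolynomial.sum_homogeneousComponent p]
  exact Finset.sum_congr rfl fun k _ => by simp [intComponent]

/-- The component of degree `n` in `⨁ᵢ S(-aᵢ)`. -/
noncomputable def shiftComponent {ι : Type} (a : ι → ℤ) (n : ℤ) : (ι → S) →ₗ[ℂ] (ι → S) :=
  LinearMap.pi fun i => intComponent (n - a i) ∘ₗ LinearMap.proj i

@[simp] theorem shiftComponent_apply {ι : Type} (a : ι → ℤ) (n : ℤ) (v : ι → S) (i : ι) :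
    shiftComponent a n v i = intComponent (n - a i) (v i) := rfl

theorem shiftComponent_idem {ι : Type} (a : ι → ℤ) (n : ℤ) (v : ι → S) :
    shiftComponent a n (shiftComponent a n v) = shiftComponent a n v := by
  ext1 i
  simp only [shiftComponent_apply]
  exact (isHomogeneousInt_intComponent _ _).intComponent_eq

theorem IsGradedMatrix.mulVec_shiftComponent {ι κ : Type} [Fintype ι] {a : ι → ℤ} {b : κ → ℤ}
    {A : Matrix κ ι S} (hA : IsGradedMatrix a b A) (n : ℤ) (v : ι → S) :
    A.mulVecLin (shiftComponent a n v) = shiftComponent b n (A.mulVecLin v) := by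
  ext1 j
  simp only [Matrix.mulVecLin_apply, Matrix.mulVec, dotProduct, shiftComponent_apply, map_sum]
  refine Finset.sum_congr rfl fun i _ => ?_
  rw [intComponent_mul (hA j i)]
  congr 2
  ring_nf

theorem gradientMap_apply (f : S) (v : Fin 3 → S) :
    gradientMap f v = ∑ i, v i * MvPolynomial.pderiv i f := by
  simp [gradientMap, Fintype.linearCombination_apply]

theorem isHomogeneousInt_pderiv {f : S} {d : ℕ} (hd : 1 ≤ d) (hf : f.IsHomogeneous d) (i : Fin 3) :
    IsHomogeneousInt (MvPolynomial.pderiv i f) ((d : ℤ) - 1) := by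
  have := isHomogeneousInt_natCast_iff.mpr (hf.pderiv (i := i))
  rwa [Nat.cast_sub hd, Nat.cast_one] at this

theorem gradientMap_shiftComponent {f : S} {d : ℕ} (hd : 1 ≤ d) (hf : f.IsHomogeneous d)
    (n : ℤ) (v : Fin 3 → S) :
    gradientMap f (shiftComponent (fun _ => (d : ℤ) - 1) n v) = intComponent n (gradientMap f v) := by
  simp only [gradientMap_apply, map_sum, shiftComponent_apply]
  refine Finset.sum_congr rfl fun i _ => ?_
  rw [mul_comm (v i), intComponent_mul (isHomogeneousInt_pderiv hd hf i), mul_comm]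

/-! ### Dimensions of graded pieces -/

theorem range_intComponent_natCast (n : ℕ) :
    LinearMap.range (intComponent n) = MvPolynomial.homogeneousSubmodule (Fin 3) ℂ n := by
  ext p
  rw [MvPolynomial.mem_homogeneousSubmodule, ← isHomogeneousInt_natCast_iff]
  constructor
  · rintro ⟨q, rfl⟩
    exact isHomogeneousInt_intComponent _ _
  · exact fun h => ⟨p, h.intComponent_eq⟩

theorem finite_homogeneousSubmodule (n : ℕ) :
    Module.Finite ℂ (MvPolynomial.homogeneousSubmodule (Fin 3) ℂ n) :=
  Module.Finite.iff_fg.mpr (MvPolynomial.homogeneousSubmodule_fg _ _ n)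

instance (n : ℤ) : Module.Finite ℂ (LinearMap.range (intComponent n)) := by
  by_cases h : 0 ≤ n
  · lift n to ℕ using h
    rw [range_intComponent_natCast]
    exact finite_homogeneousSubmodule n
  · have : intComponent n = 0 := if_neg h
    rw [this, LinearMap.range_zero]
    infer_instance

theorem finrank_homogeneousSubmodule (n : ℕ) :
    Module.finrank ℂ (MvPolynomial.homogeneousSubmodule (Fin 3) ℂ n) = (n + 2).choose 2 := by
  have e : MvPolynomial.homogeneousSubmodule (Fin 3) ℂ n ≃ₗ[ℂ]
      ({u : Fin 3 →₀ ℕ | u.degree = n} →₀ ℂ) :=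
    LinearEquiv.ofEq _ _ (MvPolynomial.homogeneousSubmodule_eq_finsupp_supported _ _ n) ≪≫ₗ
      AddMonoidAlgebra.supportedEquivFinsupp _
  have hs : {u : Fin 3 →₀ ℕ | u.degree = n} =
      ↑((Finset.univ : Finset (Fin 3)).finsuppAntidiag n) := by
    ext u
    simp [Finset.mem_finsuppAntidiag, Finsupp.degree_eq_sum]
  rw [e.finrank_eq, hs, Module.finrank_finsupp_self]
  refine (Fintype.card_coe _).trans ?_
  rw [Finset.card_finsuppAntidiag_nat_eq_choose, Finset.card_univ, Fintype.card_fin,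
    show 3 + n - 1 = n + 2 by omega]
  exact Nat.choose_symm_add

theorem finrank_range_intComponent {n : ℤ} (hn : 0 ≤ n) :
    (Module.finrank ℂ (LinearMap.range (intComponent n)) : ℚ) = (n + 1) * (n + 2) / 2 := by
  lift n to ℕ using hn
  rw [range_intComponent_natCast, finrank_homogeneousSubmodule, Nat.cast_choose_two]
  push_cast
  ring

/-- The degree `n` part of `⨁ᵢ S(-aᵢ)` is the product of the corresponding parts of `S`. -/
noncomputable def rangeShiftComponentEquiv {ι : Type} (a : ι → ℤ) (n : ℤ) :
    LinearMap.range (shiftComponent a n) ≃ₗ[ℂ] ∀ i, LinearMap.range (intComponent (n - a i)) where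
  toFun v i := ⟨v.1 i, by
    obtain ⟨w, hw⟩ := v.2
    exact ⟨w i, by rw [← hw]; rfl⟩⟩
  invFun w := ⟨fun i => (w i).1, fun i => (w i).1, by
    ext1 i
    obtain ⟨q, hq⟩ := (w i).2
    simp only [shiftComponent_apply, ← hq]
    exact (isHomogeneousInt_intComponent _ _).intComponent_eq⟩
  left_inv _ := rfl
  right_inv _ := rfl
  map_add' _ _ := rfl
  map_smul' _ _ := rfl

instance {ι : Type} [Finite ι] (a : ι → ℤ) (n : ℤ) :
    Module.Finite ℂ (LinearMap.range (shiftComponent a n)) :=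
  Module.Finite.equiv (rangeShiftComponentEquiv a n).symm

theorem finrank_range_shiftComponent {ι : Type} [Fintype ι] {a : ι → ℤ} {n : ℤ}
    (hn : ∀ i, a i ≤ n) :
    (Module.finrank ℂ (LinearMap.range (shiftComponent a n)) : ℚ) =
      ∑ i, ((n : ℚ) - a i + 1) * (n - a i + 2) / 2 := by
  rw [(rangeShiftComponentEquiv a n).finrank_eq, Module.finrank_pi_fintype, Nat.cast_sum]
  refine Finset.sum_congr rfl fun i _ => ?_
  rw [finrank_range_intComponent (sub_nonneg.mpr (hn i))]
  push_cast
  ring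

/-! ### Hilbert function of a graded resolution -/

/-- Exactness passes to graded pieces: projecting a preimage of a homogeneous element gives a
homogeneous preimage. Here `p` and `q` play the projections. -/
theorem map_range_eq_range_inf_ker {D E F : Type*} [AddCommGroup D] [Module ℂ D] [AddCommGroup E]
    [Module ℂ E] [AddCommGroup F] [Module ℂ F] {ψ : D →ₗ[ℂ] E} {φ : E →ₗ[ℂ] F}
    (hex : Function.Exact ψ φ) {q : D →ₗ[ℂ] D} {p : E →ₗ[ℂ] E} (hp : ∀ x, p (p x) = p x)
    (hq : ∀ x, ψ (q x) = p (ψ x)) :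
    (LinearMap.range q).map ψ = LinearMap.range p ⊓ LinearMap.ker φ := by
  ext x
  constructor
  · rintro ⟨_, ⟨y, rfl⟩, rfl⟩
    exact ⟨⟨ψ y, (hq y).symm⟩, (hex _).mpr ⟨_, rfl⟩⟩
  · rintro ⟨⟨y, rfl⟩, hx⟩
    obtain ⟨z, hz⟩ := (hex _).mp hx
    exact ⟨q z, ⟨z, rfl⟩, by rw [hq, hz, hp]⟩

theorem finrank_map_add_finrank_map {D E F : Type*} [AddCommGroup D] [Module ℂ D] [AddCommGroup E]
    [Module ℂ E] [AddCommGroup F] [Module ℂ F] {ψ : D →ₗ[ℂ] E} {φ : E →ₗ[ℂ] F}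
    (hex : Function.Exact ψ φ) {q : D →ₗ[ℂ] D} {p : E →ₗ[ℂ] E} (hp : ∀ x, p (p x) = p x)
    (hq : ∀ x, ψ (q x) = p (ψ x)) [Module.Finite ℂ (LinearMap.range p)] :
    Module.finrank ℂ ((LinearMap.range p).map φ) + Module.finrank ℂ ((LinearMap.range q).map ψ) =
      Module.finrank ℂ (LinearMap.range p) := by
  rw [map_range_eq_range_inf_ker hex hp hq,
    ← (φ.domRestrict (LinearMap.range p)).finrank_range_add_finrank_ker, LinearMap.range_domRestrict,
    LinearMap.ker_domRestrict, ← Submodule.map_comap_subtype, Submodule.finrank_map_subtype_eq]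

theorem exact_gradientMap_mkₐ (f : S) :
    Function.Exact ((gradientMap f).restrictScalars ℂ)
      (Ideal.Quotient.mkₐ ℂ (jacobianIdeal f)).toLinearMap := by
  intro x
  have h : x ∈ jacobianIdeal f ↔ x ∈ LinearMap.range (gradientMap f) := by
    rw [gradientMap, Fintype.range_linearCombination]
    rfl
  exact Ideal.Quotient.eq_zero_iff_mem.trans h

/-- The space of all `a f_x + b f_y + c f_z` with `a, b, c` homogeneous of degree `k - (d - 1)`. -/
noncomputable def jacobianPart (f : S) (d : ℕ) (k : ℤ) : Submodule ℂ S :=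
  (LinearMap.range (shiftComponent (fun _ : Fin 3 => (d : ℤ) - 1) k)).map
    ((gradientMap f).restrictScalars ℂ)

theorem milnorDim_add_finrank {f : S} {d : ℕ} (hd : 1 ≤ d) (hf : f.IsHomogeneous d) (k : ℕ) :
    (milnorDim f k : ℚ) + Module.finrank ℂ (jacobianPart f d k) = (k + 1) * (k + 2) / 2 := by
  have := finrank_map_add_finrank_map (exact_gradientMap_mkₐ f)
    (q := shiftComponent (fun _ => (d : ℤ) - 1) k) (p := intComponent k)
    (fun x => (isHomogeneousInt_intComponent _ _).intComponent_eq)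
    (fun x => gradientMap_shiftComponent hd hf k x)
  have h2 := finrank_range_intComponent (n := (k : ℤ)) (by positivity)
  rw [← this] at h2
  push_cast at h2
  rw [← h2, range_intComponent_natCast]
  rfl

/-- The Hilbert function of the Milnor algebra, computed from a graded resolution. -/
theorem milnorDim_eq_of_resolution {f : S} {d m n r : ℕ} (hd : 1 ≤ d) (hf : f.IsHomogeneous d)
    {e : Fin n → ℤ} {A : Matrix (Fin 3) (Fin m) S} {B : Matrix (Fin m) (Fin n) S}
    (h : IsMinimalResolution f d (fun _ => r) e A B) {k : ℕ} (hk : d + r ≤ k)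
    (he : ∀ j, e j ≤ k) :
    (milnorDim f k : ℚ) = (k + 1) * (k + 2) / 2 - 3 * ((k - (d - 1) + 1) * (k - (d - 1) + 2) / 2)
      + m * ((k - (d - 1 + r) + 1) * (k - (d - 1 + r) + 2) / 2)
      - ∑ j, ((k : ℚ) - e j + 1) * (k - e j + 2) / 2 := by
  have h0 := milnorDim_add_finrank hd hf k
  have h1 := finrank_map_add_finrank_map (ψ := A.mulVecLin.restrictScalars ℂ)
    (φ := (gradientMap f).restrictScalars ℂ) h.exact_gradient
    (q := shiftComponent (fun j => (d : ℤ) - 1 + r) k)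
    (p := shiftComponent (fun _ => (d : ℤ) - 1) k) (shiftComponent_idem _ _)
    (h.graded_A.mulVec_shiftComponent k)
  have h2 := finrank_map_add_finrank_map (ψ := B.mulVecLin.restrictScalars ℂ)
    (φ := A.mulVecLin.restrictScalars ℂ) h.exact_A
    (q := shiftComponent e k)
    (p := shiftComponent (fun _ => (d : ℤ) - 1 + r) k) (shiftComponent_idem _ _)
    (h.graded_B.mulVec_shiftComponent k)
  -- At the left end of the resolution injectivity replaces the image of the degree-`k` piece by the
  -- piece itself.
  rw [← (Submodule.equivMapOfInjective (B.mulVecLin.restrictScalars ℂ) h.injective_B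
    (LinearMap.range (shiftComponent e k))).finrank_eq] at h2
  have e1 := finrank_range_shiftComponent (a := fun _ : Fin 3 => (d : ℤ) - 1) (n := k)
    (fun _ => by omega)
  have e2 := finrank_range_shiftComponent (a := fun _ : Fin m => (d : ℤ) - 1 + r) (n := k)
    (fun _ => by omega)
  have e3 := finrank_range_shiftComponent (a := e) (n := k) he
  rw [← h1] at e1
  rw [← h2] at e2
  simp only [Finset.sum_const, Finset.card_univ, Fintype.card_fin, nsmul_eq_mul] at e1 e2
  push_cast at e1 e2 e3
  rw [e3] at e2
  unfold jacobianPart at h0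
  linear_combination h0 - e1 + e2

/-! ### Boundedness of the Hilbert function -/

/-- Coprimality leaves only the Koszul relation between the two forms, so in large degree their
ideal has codimension at most (d - 1)², and the Jacobian ideal contains it. -/
theorem milnorDim_le_of_exact {f : S} {d : ℕ} (hd : 1 ≤ d) (hf : f.IsHomogeneous d)
    (t : ℂ) (hrel : IsRelPrime (MvPolynomial.pderiv 0 f)
      (MvPolynomial.pderiv 1 f + MvPolynomial.C t * MvPolynomial.pderiv 2 f))
    (h0 : MvPolynomial.pderiv 0 f ≠ 0) {k : ℕ} (hk : 2 * d ≤ k) :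
    (milnorDim f k : ℚ) ≤ (d - 1) ^ 2 := by
  set g := MvPolynomial.pderiv 0 f with hg
  set h := MvPolynomial.pderiv 1 f + MvPolynomial.C t * MvPolynomial.pderiv 2 f with hh
  have hgd : IsHomogeneousInt g ((d : ℤ) - 1) := isHomogeneousInt_pderiv hd hf 0
  have hC : IsHomogeneousInt (MvPolynomial.C t : S) 0 := by
    exact_mod_cast isHomogeneousInt_natCast_iff.mpr (MvPolynomial.isHomogeneous_C _ t)
  have hhd : IsHomogeneousInt h ((d : ℤ) - 1) :=
    (isHomogeneousInt_pderiv hd hf 1).add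
      (by simpa using hC.mul (isHomogeneousInt_pderiv hd hf 2))
  -- `T` sends (a, b) to (a, b, tb), turning a combination of `g` and `h` into one of the three
  -- partials; `H` is the Koszul relation.
  let T : Matrix (Fin 3) (Fin 2) S := !![1, 0; 0, 1; 0, MvPolynomial.C t]
  let H : Matrix (Fin 2) (Fin 1) S := !![h; -g]
  have hone : IsHomogeneousInt (1 : S) 0 := by
    exact_mod_cast isHomogeneousInt_natCast_iff.mpr (MvPolynomial.isHomogeneous_one _ _)
  have hT : IsGradedMatrix (fun _ => (d : ℤ) - 1) (fun _ => (d : ℤ) - 1) T := by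
    intro j i
    rw [sub_self]
    fin_cases j <;> fin_cases i <;>
      first | exact hone | exact isHomogeneousInt_zero _ | exact hC
  have hH : IsGradedMatrix (fun _ => 2 * ((d : ℤ) - 1)) (fun _ => (d : ℤ) - 1) H := by
    intro j i
    rw [two_mul, add_sub_cancel_right]
    fin_cases j <;> fin_cases i
    · exact hhd
    · exact hgd.neg
  have hφ (v : Fin 2 → S) : gradientMap f (T.mulVecLin v) = v 0 * g + v 1 * h := by
    simp [gradientMap_apply, T, dotProduct, Fin.sum_univ_succ, hg, hh]
    ring
  have hex : Function.Exact (H.mulVecLin.restrictScalars ℂ)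
      ((gradientMap f).restrictScalars ℂ ∘ₗ T.mulVecLin.restrictScalars ℂ) := by
    intro v
    change gradientMap f (T.mulVecLin v) = 0 ↔ ∃ w, H.mulVecLin w = v
    rw [hφ]
    constructor
    · intro hv
      have h1 : g ∣ v 1 * h := ⟨-v 0, by linear_combination hv⟩
      obtain ⟨w, hw⟩ := hrel.dvd_of_dvd_mul_right h1
      have h2 : v 0 = -(h * w) := mul_left_cancel₀ h0 (by rw [hw] at hv; linear_combination hv)
      refine ⟨fun _ => -w, funext fun i => ?_⟩
      fin_cases i
      · simp [H, Matrix.mulVec, dotProduct, h2]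
      · simp [H, Matrix.mulVec, dotProduct, hw]
    · rintro ⟨w, rfl⟩
      simp [H, Matrix.mulVec, dotProduct]
      ring
  have key := finrank_map_add_finrank_map hex
    (q := shiftComponent (fun _ => 2 * ((d : ℤ) - 1)) k)
    (p := shiftComponent (fun _ => (d : ℤ) - 1) k) (shiftComponent_idem _ _)
    (hH.mulVec_shiftComponent k)
  have hle : (LinearMap.range (shiftComponent (fun _ : Fin 2 => (d : ℤ) - 1) k)).map
      ((gradientMap f).restrictScalars ℂ ∘ₗ T.mulVecLin.restrictScalars ℂ) ≤
      jacobianPart f d k := by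
    rw [Submodule.map_comp]
    refine Submodule.map_mono ?_
    rintro _ ⟨_, ⟨v, rfl⟩, rfl⟩
    exact ⟨T.mulVecLin v, (hT.mulVec_shiftComponent k v).symm⟩
  have : Module.Finite ℂ (jacobianPart f d k) := by
    unfold jacobianPart
    infer_instance
  have l1 := Submodule.finrank_mono hle
  have l2 := Submodule.finrank_map_le (H.mulVecLin.restrictScalars ℂ)
    (LinearMap.range (shiftComponent (fun _ : Fin 1 => 2 * ((d : ℤ) - 1)) k))
  have e1 := finrank_range_shiftComponent (a := fun _ : Fin 2 => (d : ℤ) - 1) (n := k)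
    (fun _ => by omega)
  have e2 := finrank_range_shiftComponent (a := fun _ : Fin 1 => 2 * ((d : ℤ) - 1)) (n := k)
    (fun _ => by omega)
  have e0 := milnorDim_add_finrank hd hf k
  rw [← key] at e1
  simp only [Finset.sum_const, Finset.card_univ, Fintype.card_fin, nsmul_eq_mul] at e1 e2
  push_cast at e1 e2
  have l1' : ((_ : ℕ) : ℚ) ≤ ((_ : ℕ) : ℚ) := Nat.cast_le.mpr l1
  have l2' : ((_ : ℕ) : ℚ) ≤ ((_ : ℕ) : ℚ) := Nat.cast_le.mpr l2
  rw [e2] at l2'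
  linarith

theorem totalDegree_pderiv_lt {p : S} {i : Fin 3} (h : MvPolynomial.pderiv i p ≠ 0) :
    (MvPolynomial.pderiv i p).totalDegree < p.totalDegree := by
  obtain ⟨u, hu, hmax⟩ := Finset.exists_mem_eq_sup (MvPolynomial.pderiv i p).support
    (MvPolynomial.support_nonempty.mpr h) fun u => u.sum fun _ e => e
  have hc : p.coeff (u + Finsupp.single i 1) ≠ 0 := by
    intro h0
    rw [MvPolynomial.mem_support_iff, MvPolynomial.coeff_pderiv, h0, zero_mul] at hu
    exact hu rfl
  have := MvPolynomial.le_totalDegree (MvPolynomial.mem_support_iff.mpr hc)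
  rw [Finsupp.sum_add_index' (fun _ => rfl) (fun _ _ _ => rfl), Finsupp.sum_single_index rfl] at this
  rw [MvPolynomial.totalDegree, hmax]
  exact this

theorem totalDegree_eq_zero_of_dvd_pderiv {p : S} (h : ∀ i, p ∣ MvPolynomial.pderiv i p) :
    p.totalDegree = 0 := by
  have h0 (i : Fin 3) : MvPolynomial.pderiv i p = 0 := by
    by_contra hi
    obtain ⟨q, hq⟩ := h i
    have hlt := totalDegree_pderiv_lt hi
    rw [hq] at hi hlt
    rw [MvPolynomial.totalDegree_mul_of_isDomain (left_ne_zero_of_mul hi)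
      (right_ne_zero_of_mul hi)] at hlt
    omega
  rw [MvPolynomial.totalDegree_eq_zero_iff]
  intro u hu i
  by_contra hi
  have := congrArg (MvPolynomial.coeff (u - Finsupp.single i 1)) (h0 i)
  rw [MvPolynomial.coeff_pderiv, tsub_add_cancel_of_le
    (by rw [Finsupp.single_le_iff]; omega), MvPolynomial.coeff_zero] at this
  rcases mul_eq_zero.mp this with h1 | h1
  · exact MvPolynomial.mem_support_iff.mp hu h1
  · exact Nat.cast_add_one_ne_zero _ h1

/-- By Euler's formula such a `p` divides f. Writing f = pg with p not dividing g, the Leibniz rule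
makes p divide its own partials, which have smaller degree, so p would be constant. -/
theorem not_prime_dvd_pderiv {f : S} {d : ℕ} (hd : 1 ≤ d) (hf : f.IsHomogeneous d)
    (hsq : Squarefree f) {p : S} (hp : Prime p) : ∃ i, ¬ p ∣ MvPolynomial.pderiv i f := by
  by_contra! h
  have hpf : p ∣ f := by
    have h1 : p ∣ d • f := by
      rw [← hf.sum_X_mul_pderiv]
      exact Finset.dvd_sum fun i _ => (h i).mul_left _
    have h2 : f = MvPolynomial.C ((d : ℂ)⁻¹) * (d • f) := by
      rw [nsmul_eq_mul, ← mul_assoc, ← map_natCast MvPolynomial.C, ← map_mul,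
        inv_mul_cancel₀ (by exact_mod_cast (by omega : d ≠ 0)), map_one, one_mul]
    rw [h2]
    exact h1.mul_left _
  obtain ⟨g, rfl⟩ := hpf
  have hg : ¬ p ∣ g := fun ⟨w, hw⟩ => hp.not_isUnit (hsq p ⟨w, by rw [hw, mul_assoc]⟩)
  have hdeg := totalDegree_eq_zero_of_dvd_pderiv (p := p) fun i => by
    have := h i
    rw [MvPolynomial.pderiv_mul] at this
    exact (hp.dvd_or_dvd ((dvd_add_left (dvd_mul_right _ _)).mp this)).resolve_right hg
  rw [MvPolynomial.totalDegree_eq_zero_iff_eq_C] at hdeg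
  refine hp.not_isUnit (hdeg ▸ IsUnit.map MvPolynomial.C (isUnit_iff_ne_zero.mpr fun h0 => ?_))
  rw [h0, map_zero] at hdeg
  exact hp.ne_zero hdeg

/-- Pigeonhole: `g` has finitely many prime factors, so if every `t` failed, one prime would serve
two values of `t` and hence divide both `b` and `a`. -/
theorem exists_isRelPrime_add_C_mul {g a b : S} (hg : g ≠ 0)
    (h : ∀ p, Prime p → p ∣ g → p ∣ a → ¬ p ∣ b) :
    ∃ t : ℂ, IsRelPrime g (a + MvPolynomial.C t * b) := by
  classical
  by_contra! hcon
  have key (t : ℂ) : ∃ p ∈ UniqueFactorizationMonoid.factors g,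
      p ∣ a + MvPolynomial.C t * b := by
    have h1 := hcon t
    rw [UniqueFactorizationMonoid.isRelPrime_iff_no_prime_factors hg] at h1
    push Not at h1
    obtain ⟨q, hqg, hqa, hq⟩ := h1
    obtain ⟨p, hp, hqp⟩ := UniqueFactorizationMonoid.exists_mem_factors_of_dvd hg hq.irreducible hqg
    exact ⟨p, hp, hqp.dvd_iff_dvd_left.mp hqa⟩
  choose p hp hpd using key
  obtain ⟨s, t, hst, he⟩ := Finite.exists_ne_map_eq_of_infinite
    (fun t => (⟨p t, by simpa using hp t⟩ : (UniqueFactorizationMonoid.factors g).toFinset))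
  have he : p s = p t := congrArg Subtype.val he
  have hpr := UniqueFactorizationMonoid.prime_of_factor _ (hp s)
  have hb : p s ∣ b := by
    have h1 : p s ∣ MvPolynomial.C (s - t) * b := by
      have := dvd_sub (hpd s) (he ▸ hpd t)
      rw [map_sub]
      convert this using 1
      ring
    have h2 : b = MvPolynomial.C ((s - t)⁻¹) * (MvPolynomial.C (s - t) * b) := by
      rw [← mul_assoc, ← map_mul, inv_mul_cancel₀ (sub_ne_zero.mpr hst), map_one, one_mul]
    rw [h2]
    exact h1.mul_left _
  exact h _ hpr (UniqueFactorizationMonoid.dvd_of_mem_factors (hp s))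
    ((dvd_add_left (hb.mul_left _)).mp (hpd s)) hb

theorem milnorDim_bounded {f : S} {d : ℕ} (hd : 1 ≤ d) (hf : f.IsHomogeneous d)
    (hsq : Squarefree f) (h0 : MvPolynomial.pderiv 0 f ≠ 0) :
    ∀ᶠ k in atTop, (milnorDim f k : ℚ) ≤ (d - 1) ^ 2 := by
  obtain ⟨t, ht⟩ := exists_isRelPrime_add_C_mul (a := MvPolynomial.pderiv 1 f)
    (b := MvPolynomial.pderiv 2 f) h0 fun p hp h1 h2 h3 => by
      obtain ⟨i, hi⟩ := not_prime_dvd_pderiv hd hf hsq hp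
      fin_cases i
      · exact hi h1
      · exact hi h2
      · exact hi h3
  filter_upwards [eventually_ge_atTop (2 * d)] with k hk
  exact milnorDim_le_of_exact hd hf t ht h0 hk

theorem coeff_eq_zero_of_bounded_quadratic {a b c C : ℚ}
    (h : ∀ᶠ k : ℕ in atTop, 0 ≤ a * k ^ 2 + b * k + c ∧ a * k ^ 2 + b * k + c ≤ C) :
    a = 0 ∧ b = 0 := by
  obtain ⟨N, hN⟩ := eventually_atTop.mp h
  have hlin {u v : ℚ} (huv : ∀ K : ℕ, u * K ≤ v) : u ≤ 0 := by
    by_contra! hu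
    obtain ⟨K, hK⟩ := exists_nat_gt (v / u)
    rw [div_lt_iff₀ hu] at hK
    linarith [huv K]
  have hq (K : ℕ) := hN (N + K) (by omega)
  have hq2 (K : ℕ) := hN (N + 2 * K) (by omega)
  have ha : a = 0 := by
    have h1 (K : ℕ) : |2 * a| * K ^ 2 ≤ 2 * C := by
      have e1 := hN N le_rfl
      have e2 := hq K
      have e3 := hq2 K
      push_cast at e1 e2 e3
      -- The second difference with step `K` isolates the quadratic coefficient.
      have : 2 * a * K ^ 2 = (a * (N + 2 * K) ^ 2 + b * (N + 2 * K) + c)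
          - 2 * (a * (N + K) ^ 2 + b * (N + K) + c) + (a * N ^ 2 + b * N + c) := by ring
      rw [← abs_of_nonneg (sq_nonneg (K : ℚ)), ← abs_mul, abs_le]
      constructor <;> linarith
    have h2 : |2 * a| ≤ 0 := hlin (v := 2 * C) fun K => by
      refine le_trans ?_ (h1 K)
      refine mul_le_mul_of_nonneg_left ?_ (abs_nonneg _)
      exact_mod_cast Nat.le_self_pow two_ne_zero K
    have := abs_nonpos_iff.mp h2
    linarith
  subst ha
  refine ⟨rfl, ?_⟩
  have e1 := hN N le_rfl
  refine le_antisymm (hlin (v := C) fun K => ?_) ?_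
  · have := hq K
    push_cast at this
    linarith
  · have : -b ≤ 0 := hlin (v := C) fun K => by
      have := hq K
      push_cast at this
      linarith
    linarith

/-! ### Regular sequences on second syzygies -/

open MvPolynomial in
theorem X_dvd_of_X_mul_add_X_mul_eq_zero {i j : Fin 3} (hij : i ≠ j) {p q : S}
    (h : (X i : S) * p + X j * q = 0) : ∃ s, q = X i * s ∧ p = -(X j * s) := by
  have h1 : (X i : S) ∣ X j * q := ⟨-p, by linear_combination h⟩
  rcases (X_prime (σ := Fin 3) (R := ℂ) (i := i)).dvd_or_dvd h1 with h2 | ⟨s, rfl⟩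
  · exact absurd (X_dvd_X.mp h2) hij
  · exact ⟨s, rfl, mul_left_cancel₀ (X_ne_zero i) (by linear_combination h)⟩

open MvPolynomial in
theorem exists_eq_of_X_mul_sum_eq_zero {p q r : S}
    (h : (X 0 : S) * p + X 1 * q + X 2 * r = 0) : ∃ s t, r = X 0 * s + X 1 * t := by
  -- Membership in (x, y) is tested monomial by monomial, so the factor z can be cancelled.
  have key : r ∈ Ideal.span (X '' ({0, 1} : Set (Fin 3)) : Set S) := by
    rw [mem_ideal_span_X_image]
    intro m hm
    have h1 : X 2 * r ∈ Ideal.span (X '' ({0, 1} : Set (Fin 3)) : Set S) := by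
      have : X 2 * r = (-p) * X 0 + (-q) * X 1 := by linear_combination h
      rw [this]
      exact add_mem (Ideal.mul_mem_left _ _ (Ideal.subset_span ⟨0, by simp, rfl⟩))
        (Ideal.mul_mem_left _ _ (Ideal.subset_span ⟨1, by simp, rfl⟩))
    rw [mem_ideal_span_X_image] at h1
    obtain ⟨i, hi, hmi⟩ := h1 (Finsupp.single 2 1 + m) (by
      rw [mem_support_iff, coeff_X_mul]
      exact mem_support_iff.mp hm)
    refine ⟨i, hi, ?_⟩
    rcases hi with rfl | rfl <;> simpa using hmi
  rw [Set.image_pair, Ideal.mem_span_pair] at key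
  obtain ⟨a, b, hab⟩ := key
  exact ⟨a, b, by rw [← hab]; ring⟩

/-- `K` satisfies the relations of depth three: `x, y, z` is a regular sequence on `K`. -/
structure HasRegularVariables {ι : Type} (K : Submodule S (ι → S)) : Prop where
  two : ∀ u ∈ K, ∀ v ∈ K, (MvPolynomial.X 0 : S) • u + (MvPolynomial.X 1 : S) • v = 0 →
    ∃ w ∈ K, v = (MvPolynomial.X 0 : S) • w
  three : ∀ u ∈ K, ∀ v ∈ K, ∀ w ∈ K, (MvPolynomial.X 0 : S) • u + (MvPolynomial.X 1 : S) • v +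
    (MvPolynomial.X 2 : S) • w = 0 →
    ∃ p ∈ K, ∃ q ∈ K, w = (MvPolynomial.X 0 : S) • p + (MvPolynomial.X 1 : S) • q

/-- A second syzygy module over `ℂ[x, y, z]` has depth three. -/
theorem hasRegularVariables_ker {ι κ : Type} {φ : (ι → S) →ₗ[S] (κ → S)} {ψ : (κ → S) →ₗ[S] S}
    (h : Function.Exact φ ψ) : HasRegularVariables (LinearMap.ker φ) where
  two u _ v hv huv := by
    choose s hs _ using fun i => X_dvd_of_X_mul_add_X_mul_eq_zero (i := 0) (j := 1) (by decide)
      (congrFun huv i)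
    have hvs : v = (MvPolynomial.X 0 : S) • s := funext hs
    refine ⟨s, ?_, hvs⟩
    rw [LinearMap.mem_ker, hvs, map_smul] at hv
    exact (smul_eq_zero.mp hv).resolve_left (MvPolynomial.X_ne_zero _)
  three u _ v _ w hw huvw := by
    choose p q hpq using fun i => exists_eq_of_X_mul_sum_eq_zero (congrFun huvw i)
    have hw' : w = (MvPolynomial.X 0 : S) • p + (MvPolynomial.X 1 : S) • q := funext hpq
    rw [LinearMap.mem_ker, hw', map_add, map_smul, map_smul] at hw
    choose s hs1 hs2 using fun i => X_dvd_of_X_mul_add_X_mul_eq_zero (i := 0) (j := 1) (by decide)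
      (congrFun hw i)
    have hp : φ p = -((MvPolynomial.X 1 : S) • s) := funext hs2
    have hq : φ q = (MvPolynomial.X 0 : S) • s := funext hs1
    have hs : ψ s = 0 := by
      have : ψ (φ q) = 0 := h.apply_apply_eq_zero q
      rw [hq, map_smul] at this
      exact (smul_eq_zero.mp this).resolve_left (MvPolynomial.X_ne_zero _)
    obtain ⟨t, ht⟩ := (h s).mp hs
    -- The lifts `p`, `q` need not lie in the kernel: φ p = -y s and φ q = x s. As s = φ t, the
    -- correction (y t, -x t) cancels both errors and leaves x p + y q unchanged.
    refine ⟨p + (MvPolynomial.X 1 : S) • t, ?_, q - (MvPolynomial.X 0 : S) • t, ?_, ?_⟩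
    · rw [LinearMap.mem_ker, map_add, map_smul, ht, hp, neg_add_cancel]
    · rw [LinearMap.mem_ker, map_sub, map_smul, ht, hq, sub_self]
    · rw [hw']
      module

/-! ### Graded Nakayama and homogeneous bases -/

theorem IsHomogeneousInt.exists_eq_sum_X_mul {p : S} {n : ℤ} (hp : IsHomogeneousInt p n)
    (h0 : MvPolynomial.constantCoeff p = 0) :
    ∃ b : Fin 3 → S, (∀ i, IsHomogeneousInt (b i) (n - 1)) ∧
      p = ∑ i, MvPolynomial.X i * b i := by
  have hmem : p ∈ Ideal.span (Set.range (MvPolynomial.X : Fin 3 → S)) := by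
    rw [← Set.image_univ, MvPolynomial.mem_ideal_span_X_image]
    intro m hm
    by_contra! hcon
    have : m = 0 := Finsupp.ext fun i => hcon i trivial
    subst this
    exact MvPolynomial.mem_support_iff.mp hm h0
  obtain ⟨c, hc⟩ := Ideal.mem_span_range_iff_exists_fun.mp hmem
  refine ⟨fun i => intComponent (n - 1) (c i), fun i => isHomogeneousInt_intComponent _ _, ?_⟩
  rw [← hp.intComponent_eq, ← hc, map_sum]
  exact Finset.sum_congr rfl fun i _ => by rw [mul_comm, intComponent_mul (isHomogeneousInt_X i)]

/-- A family of vectors, homogeneous of degrees `ε`, generating `K`. -/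
structure IsHomogeneousGenerators {m n : ℕ} (K : Submodule S (Fin m → S)) (ε : Fin n → ℤ)
    (g : Fin n → Fin m → S) : Prop where
  homogeneous : ∀ j i, IsHomogeneousInt (g j i) (ε j)
  span_eq : Submodule.span S (Set.range g) = K

theorem mem_of_forall_shiftComponent_mem {m : ℕ} {K : Submodule S (Fin m → S)} {v : Fin m → S}
    (h : ∀ k : ℕ, shiftComponent 0 k v ∈ K) : v ∈ K := by
  let N := Finset.univ.sup fun i => (v i).totalDegree
  have : v = ∑ k ∈ Finset.range (N + 1), shiftComponent 0 k v := by
    ext1 i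
    rw [Finset.sum_apply]
    simp only [shiftComponent_apply, Pi.zero_apply, sub_zero]
    have hle : (v i).totalDegree ≤ N :=
      Finset.le_sup (f := fun i => (v i).totalDegree) (Finset.mem_univ i)
    rw [← Finset.sum_subset (Finset.range_mono (Nat.add_le_add_right hle 1)), sum_intComponent]
    intro k _ hk
    simp only [Finset.mem_range, not_lt] at hk
    simp only [intComponent, Nat.cast_nonneg, if_true, Int.toNat_natCast]
    exact MvPolynomial.homogeneousComponent_eq_zero _ _ (by omega)
  rw [this]
  exact Submodule.sum_mem _ fun k _ => h k

theorem exists_isHomogeneousGenerators {m : ℕ} (K : Submodule S (Fin m → S))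
    (hK : ∀ v ∈ K, ∀ k : ℕ, shiftComponent 0 k v ∈ K) :
    ∃ (n : ℕ) (ε : Fin n → ℤ) (g : Fin n → Fin m → S), IsHomogeneousGenerators K ε g := by
  let T : Set (Fin m → S) := {v | v ∈ K ∧ ∃ e : ℤ, ∀ i, IsHomogeneousInt (v i) e}
  have hT : Submodule.span S T = K := by
    refine le_antisymm (Submodule.span_le.mpr fun v hv => hv.1) fun v hv => ?_
    refine mem_of_forall_shiftComponent_mem fun k => Submodule.subset_span ⟨hK v hv k, k, fun i => ?_⟩
    rw [shiftComponent_apply, Pi.zero_apply, sub_zero]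
    exact isHomogeneousInt_intComponent _ _
  obtain ⟨s, hsT, hs⟩ := (Submodule.fg_span_iff_fg_span_finset_subset T).mp
    (IsNoetherian.noetherian (R := S) _)
  have hmem (j : Fin s.card) : (s.equivFin.symm j : Fin m → S) ∈ T := hsT (s.equivFin.symm j).2
  choose _ ε hε using hmem
  refine ⟨s.card, ε, fun j => s.equivFin.symm j, hε, ?_⟩
  rw [← hT, hs]
  congr 1
  ext v
  constructor
  · rintro ⟨j, rfl⟩
    exact (s.equivFin.symm j).2
  · exact fun hv => ⟨s.equivFin ⟨v, hv⟩, by simp⟩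

/-- The map `a ↦ ∑ⱼ aⱼ gⱼ` commutes with taking homogeneous components. -/
theorem linearCombination_shiftComponent {m n : ℕ} {ε : Fin n → ℤ} {g : Fin n → Fin m → S}
    (hg : ∀ j i, IsHomogeneousInt (g j i) (ε j)) (k : ℤ) (a : Fin n → S) :
    Fintype.linearCombination S g (shiftComponent ε k a) =
      shiftComponent 0 k (Fintype.linearCombination S g a) := by
  ext1 i
  simp only [Fintype.linearCombination_apply, Finset.sum_apply, Pi.smul_apply, smul_eq_mul,
    shiftComponent_apply, Pi.zero_apply, sub_zero, map_sum]
  refine Finset.sum_congr rfl fun j _ => ?_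
  rw [mul_comm (a j), intComponent_mul (hg j i), mul_comm]

theorem shiftComponent_X_smul {ι : Type} (ε : ι → ℤ) (i : Fin 3) (k : ℤ) (v : ι → S) :
    shiftComponent ε k ((MvPolynomial.X i : S) • v) =
      (MvPolynomial.X i : S) • shiftComponent ε (k - 1) v := by
  ext1 j
  simp only [shiftComponent_apply, Pi.smul_apply, smul_eq_mul, intComponent_mul (isHomogeneousInt_X i)]
  congr 2
  ring_nf

theorem shiftComponent_eq_self_iff {ι : Type} {ε : ι → ℤ} {k : ℤ} {v : ι → S} :
    shiftComponent ε k v = v ↔ ∀ j, IsHomogeneousInt (v j) (k - ε j) := by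
  constructor
  · intro h j
    rw [← h]
    exact isHomogeneousInt_intComponent _ _
  · exact fun h => funext fun j => (h j).intComponent_eq

theorem IsHomogeneousInt.eq_C_of_constantCoeff_ne_zero {p : S} {n : ℤ} (hp : IsHomogeneousInt p n)
    (h : MvPolynomial.constantCoeff p ≠ 0) :
    p = MvPolynomial.C (MvPolynomial.constantCoeff p) := by
  have hn : (0 : ℤ) = n := by
    have := hp 0 h
    rwa [map_zero, Nat.cast_zero] at this
  exact (hn ▸ hp).eq_C

/-- A generator with coefficient a unit in a relation is redundant. -/
theorem mem_span_of_relation {M : Type*} [AddCommGroup M] [Module S M] {n : ℕ} {g : Fin n → M}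
    {a : Fin n → S} (h : ∑ i, a i • g i = 0) {j : Fin n} {c : ℂ} (hc : c ≠ 0)
    (hj : a j = MvPolynomial.C c) : g j ∈ Submodule.span S (g '' {j}ᶜ) := by
  rw [← Finset.add_sum_erase _ _ (Finset.mem_univ j), hj, add_eq_zero_iff_eq_neg] at h
  have h1 : g j = (MvPolynomial.C c⁻¹ : S) • (MvPolynomial.C c : S) • g j := by
    rw [smul_smul, ← map_mul, inv_mul_cancel₀ hc, map_one, one_smul]
  rw [h1, h]
  refine Submodule.smul_mem _ _ (neg_mem (Submodule.sum_mem _ fun i hi => ?_))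
  exact Submodule.smul_mem _ _ (Submodule.subset_span ⟨i, Finset.ne_of_mem_erase hi, rfl⟩)

open MvPolynomial in
/-- Graded Nakayama argument: over `ℂ[x, y, z]`, homogeneous generators without units in their
homogeneous relations are free generators if `x, y, z` is a regular sequence. -/
theorem homogeneous_relation_eq_zero {m n : ℕ} {K : Submodule S (Fin m → S)}
    (hK : HasRegularVariables K) {ε : Fin n → ℤ} (hε : ∀ j, 0 ≤ ε j) {g : Fin n → Fin m → S}
    (hg : IsHomogeneousGenerators K ε g)
    (hmin : ∀ (k : ℤ) (a : Fin n → S), shiftComponent ε k a = a →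
      Fintype.linearCombination S g a = 0 → ∀ j, constantCoeff (a j) = 0)
    (D : ℕ) : ∀ a : Fin n → S, shiftComponent ε D a = a →
      Fintype.linearCombination S g a = 0 → a = 0 := by
  have hmem (v : Fin n → S) : Fintype.linearCombination S g v ∈ K := by
    rw [← hg.span_eq, ← Fintype.range_linearCombination]
    exact ⟨v, rfl⟩
  have hsurj {w : Fin m → S} (hw : w ∈ K) : ∃ v, Fintype.linearCombination S g v = w := by
    rwa [← hg.span_eq, ← Fintype.range_linearCombination] at hw
  induction D with
  | zero =>
    intro a ha h0
    ext1 j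
    have h1 := shiftComponent_eq_self_iff.mp ha j
    rcases (hε j).lt_or_eq with h | h
    · exact h1.eq_zero_of_neg (by push_cast; omega)
    · rw [← h, Nat.cast_zero, sub_zero] at h1
      rw [h1.eq_C, hmin _ a ha h0 j, map_zero]
      rfl
  | succ D ih =>
    intro a ha h0
    -- By induction there are no nonzero relations in degree `D`, so a degree-`D` preimage is
    -- determined by its image.
    have hlift {v w : Fin n → S} (hv : shiftComponent ε D v = v)
        (hvw : Fintype.linearCombination S g v = Fintype.linearCombination S g w) :
        v = shiftComponent ε D w := by
      have := ih (shiftComponent ε D (v - w)) (shiftComponent_idem _ _ _) (by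
        rw [linearCombination_shiftComponent hg.homogeneous, map_sub, hvw, sub_self, map_zero])
      rw [map_sub, hv, sub_eq_zero] at this
      exact this
    choose b hb hab using fun j => (shiftComponent_eq_self_iff.mp ha j).exists_eq_sum_X_mul
      (hmin _ a ha h0 j)
    have hb' (i : Fin 3) : shiftComponent ε D (fun j => b j i) = fun j => b j i :=
      shiftComponent_eq_self_iff.mpr fun j => by
        have := hb j i
        rwa [Nat.cast_succ, add_sub_right_comm, add_sub_cancel_right] at this
    have ha' : a = (X 0 : S) • (fun j => b j 0) + (X 1 : S) • (fun j => b j 1) +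
        (X 2 : S) • (fun j => b j 2) := by
      ext1 j
      rw [hab j]
      simp [Fin.sum_univ_three]
    replace hb := (⟨hb' 0, hb' 1, hb' 2⟩ : _ ∧ _ ∧ _)
    clear hab hb'
    generalize (fun j => b j 0) = b0, (fun j => b j 1) = b1, (fun j => b j 2) = b2 at ha' hb
    obtain ⟨hb0, hb1, hb2⟩ := hb
    set G := Fintype.linearCombination S g
    have h1 : (X 0 : S) • G b0 + (X 1 : S) • G b1 + (X 2 : S) • G b2 = 0 := by
      rw [← h0, ha']
      simp only [map_add, map_smul]
    obtain ⟨p, hp, q, hq, hpq⟩ := hK.three _ (hmem b0) _ (hmem b1) _ (hmem b2) h1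
    obtain ⟨u, rfl⟩ := hsurj hp
    obtain ⟨v, rfl⟩ := hsurj hq
    have h2 := hlift (w := (X 0 : S) • u + (X 1 : S) • v) hb2
      (by rw [hpq, map_add, map_smul, map_smul])
    rw [map_add, shiftComponent_X_smul, shiftComponent_X_smul] at h2
    have hc (i : Fin 3) (w : Fin n → S) : shiftComponent ε D
        ((X i : S) • shiftComponent ε (D - 1) w) = (X i : S) • shiftComponent ε (D - 1) w := by
      rw [shiftComponent_X_smul, shiftComponent_idem]
    -- Since b2 = x u' + y v', with u', v' the components of u, v in degree D - 1, the z-term of `a`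
    -- can be absorbed into the x- and y-terms. The same device then absorbs the y-term, leaving x
    -- times a relation of degree `D`, which vanishes by induction.
    obtain ⟨c0, hc0⟩ : ∃ c0, c0 = b0 + (X 2 : S) • shiftComponent ε (D - 1) u := ⟨_, rfl⟩
    obtain ⟨c1, hc1⟩ : ∃ c1, c1 = b1 + (X 2 : S) • shiftComponent ε (D - 1) v := ⟨_, rfl⟩
    have hac : a = (X 0 : S) • c0 + (X 1 : S) • c1 := by
      rw [ha', h2, hc0, hc1]
      module
    have h3 : (X 0 : S) • G c0 + (X 1 : S) • G c1 = 0 := by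
      rw [← h0, hac]
      simp only [map_add, map_smul]
    obtain ⟨w, hw, hw1⟩ := hK.two _ (hmem c0) _ (hmem c1) h3
    obtain ⟨t, rfl⟩ := hsurj hw
    have h4 := hlift (v := c1) (w := (X 0 : S) • t) (by rw [hc1, map_add, hb1, hc])
      (by rw [map_smul]; exact hw1)
    rw [shiftComponent_X_smul] at h4
    have hac' : a = (X 0 : S) • (c0 + (X 1 : S) • shiftComponent ε (D - 1) t) := by
      rw [hac, h4]
      module
    have h5 : G (c0 + (X 1 : S) • shiftComponent ε (D - 1) t) = 0 := by
      rw [hac', map_smul] at h0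
      exact (smul_eq_zero.mp h0).resolve_left (X_ne_zero _)
    have h6 := ih (c0 + (X 1 : S) • shiftComponent ε (D - 1) t)
      (by rw [map_add, hc, hc0, map_add, hb0, hc]) h5
    rw [hac', h6, smul_zero]

theorem eq_zero_of_forall_shiftComponent_eq_zero {n : ℕ} {ε : Fin n → ℤ} (hε : ∀ j, 0 ≤ ε j)
    {a : Fin n → S} (h : ∀ D : ℕ, shiftComponent ε D a = 0) : a = 0 := by
  ext j u
  have h1 := congrArg (MvPolynomial.coeff u) (congrFun (h (u.degree + (ε j).toNat)) j)
  rw [shiftComponent_apply, coeff_intComponent, if_pos] at h1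
  · exact h1
  · push_cast
    rw [Int.toNat_of_nonneg (hε j)]
    ring

/-- A graded submodule of `S^m` on which `x, y, z` is a regular sequence is free, with a
homogeneous basis. -/
theorem exists_homogeneous_basis {m : ℕ} {K : Submodule S (Fin m → S)}
    (hKgr : ∀ v ∈ K, ∀ k : ℕ, shiftComponent 0 k v ∈ K) (hK : HasRegularVariables K) :
    ∃ (n : ℕ) (ε : Fin n → ℤ) (g : Fin n → Fin m → S), IsHomogeneousGenerators K ε g ∧
      Function.Injective (Fintype.linearCombination S g) := by
  classical
  have hex := exists_isHomogeneousGenerators K hKgr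
  -- With the fewest homogeneous generators none is redundant, so no homogeneous relation has a unit
  -- coefficient.
  obtain ⟨n, ⟨ε, g, hg⟩, hmin⟩ : ∃ n, (∃ (ε : Fin n → ℤ) (g : Fin n → Fin m → S),
      IsHomogeneousGenerators K ε g) ∧ ∀ n' < n, ¬ ∃ (ε : Fin n' → ℤ) (g : Fin n' → Fin m → S),
      IsHomogeneousGenerators K ε g :=
    ⟨Nat.find hex, Nat.find_spec hex, fun n' h => Nat.find_min hex h⟩
  have hirr (j : Fin n) (h : g j ∈ Submodule.span S (g '' {j}ᶜ)) : False := by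
    obtain _ | n := n
    · exact j.elim0
    refine hmin n n.lt_succ_self ⟨ε ∘ j.succAbove, g ∘ j.succAbove, fun i => hg.homogeneous _, ?_⟩
    rw [Set.range_comp, Fin.range_succAbove, ← hg.span_eq]
    refine le_antisymm (Submodule.span_mono (Set.image_subset_range _ _))
      (Submodule.span_le.mpr ?_)
    rintro _ ⟨i, rfl⟩
    by_cases hij : i = j
    · exact hij ▸ h
    · exact Submodule.subset_span ⟨i, hij, rfl⟩
  have hε (j : Fin n) : 0 ≤ ε j := by
    by_contra! hneg
    refine hirr j ?_
    have : g j = 0 := funext fun i => (hg.homogeneous j i).eq_zero_of_neg hneg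
    rw [this]
    exact zero_mem _
  refine ⟨n, ε, g, hg, (injective_iff_map_eq_zero _).mpr fun a ha => ?_⟩
  refine eq_zero_of_forall_shiftComponent_eq_zero hε fun D => ?_
  refine homogeneous_relation_eq_zero hK hε hg (fun k a ha h0 j => ?_) D _
    (shiftComponent_idem _ _ _) (by rw [linearCombination_shiftComponent hg.homogeneous, ha, map_zero])
  by_contra hc
  exact hirr j (mem_span_of_relation (by rwa [Fintype.linearCombination_apply] at h0) hc
    ((shiftComponent_eq_self_iff.mp ha j).eq_C_of_constantCoeff_ne_zero hc))

/-! ### Numerics and existence of the resolution -/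

theorem resolution_numerics {f : S} {d m n r : ℕ} (hd : 1 ≤ d) (hf : f.IsHomogeneous d)
    (hsq : Squarefree f) (h0 : MvPolynomial.pderiv 0 f ≠ 0)
    {e : Fin n → ℤ} {A : Matrix (Fin 3) (Fin m) S} {B : Matrix (Fin m) (Fin n) S}
    (h : IsMinimalResolution f d (fun _ => r) e A B) :
    n + 2 = m ∧ ∑ j, e j = m * ((d : ℤ) - 1 + r) - 3 * (d - 1) ∧
      ∀ᶠ k in atTop, (milnorDim f k : ℚ) =
        (m * ((d : ℚ) - 1 + r) ^ 2 - 3 * (d - 1) ^ 2 - ∑ j, (e j : ℚ) ^ 2) / 2 := by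
  set q : ℚ := (d : ℚ) - 1 with hq
  set s1 : ℚ := ∑ j, (e j : ℚ) with hs1
  set s2 : ℚ := ∑ j, (e j : ℚ) ^ 2 with hs2
  -- These are the coefficients of the quadratic in `k` given by the resolution, written with q = d
  -- - 1.
  set a : ℚ := ((m : ℚ) - 2 - n) / 2 with ha
  set b : ℚ := (3 - 3 * (3 - 2 * q) + m * (3 - 2 * (q + r)) - (3 * n - 2 * s1)) / 2 with hb
  set c : ℚ := (2 - 3 * (q ^ 2 - 3 * q + 2) + m * ((q + r) ^ 2 - 3 * (q + r) + 2)
    - (s2 - 3 * s1 + 2 * n)) / 2 with hc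
  have hev : ∀ᶠ k : ℕ in atTop, (milnorDim f k : ℚ) = a * k ^ 2 + b * k + c := by
    have he : ∀ᶠ k : ℕ in atTop, ∀ j, e j ≤ k := by
      filter_upwards [eventually_ge_atTop (∑ j, (e j).toNat)] with k hk j
      have := Finset.single_le_sum (f := fun j => (e j).toNat) (fun _ _ => Nat.zero_le _)
        (Finset.mem_univ j)
      omega
    filter_upwards [he, eventually_ge_atTop (d + r)] with k he hk
    rw [milnorDim_eq_of_resolution hd hf h hk he]
    have hsum : ∑ j, ((k : ℚ) - e j + 1) * (k - e j + 2) / 2 =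
        n * ((k ^ 2 + 3 * k + 2) / 2) - (2 * k + 3) / 2 * s1 + s2 / 2 := by
      have (j : Fin n) : ((k : ℚ) - e j + 1) * (k - e j + 2) / 2 =
          (k ^ 2 + 3 * k + 2) / 2 - (2 * k + 3) / 2 * e j + (e j : ℚ) ^ 2 / 2 := by ring
      simp only [this, Finset.sum_add_distrib, Finset.sum_sub_distrib, ← Finset.mul_sum,
        ← Finset.sum_div, Finset.sum_const, Finset.card_univ, Fintype.card_fin, nsmul_eq_mul]
      ring
    rw [hsum, ha, hb, hc]
    ring
  have hab : a = 0 ∧ b = 0 := by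
    refine coeff_eq_zero_of_bounded_quadratic (c := c) (C := (d - 1) ^ 2) ?_
    filter_upwards [hev, milnorDim_bounded hd hf hsq h0] with k h1 h2
    rw [← h1]
    exact ⟨Nat.cast_nonneg _, h2⟩
  have hn : (m : ℚ) = n + 2 := by linarith [hab.1]
  have hs : s1 = m * (q + r) - 3 * q := by
    have := hab.2
    rw [hb] at this
    linarith
  refine ⟨by exact_mod_cast hn.symm, ?_, ?_⟩
  · rw [hs1, hq] at hs
    exact_mod_cast hs
  · filter_upwards [hev] with k hk
    rw [hk, hab.1, hab.2, hc, hs, hn]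
    ring

theorem exists_minimalResolution {f : S} {d m r : ℕ} (hr : 1 ≤ r)
    {ρ : Fin m → Fin 3 → S} (hρ : IsMinimalGenerators f (fun _ => r) ρ) :
    ∃ (n : ℕ) (e : Fin n → ℤ) (A : Matrix (Fin 3) (Fin m) S) (B : Matrix (Fin m) (Fin n) S),
      IsMinimalResolution f d (fun _ : Fin m => r) e A B := by
  let A : Matrix (Fin 3) (Fin m) S := Matrix.of fun i j => ρ j i
  have hAv (v : Fin m → S) : A.mulVecLin v = ∑ j, v j • ρ j := by
    rw [Matrix.mulVecLin_apply, Matrix.mulVec_eq_sum]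
    exact Finset.sum_congr rfl fun j _ => op_smul_eq_smul _ _
  have hAr : LinearMap.range A.mulVecLin = D0 f := by
    rw [← hρ.span_eq, ← Fintype.range_linearCombination]
    congr 1
    refine LinearMap.ext fun v => ?_
    rw [hAv, Fintype.linearCombination_apply]
  have hexA : Function.Exact A.mulVecLin (gradientMap f) :=
    LinearMap.exact_iff.mpr hAr.symm
  have hAhom (i j) : IsHomogeneousInt (A i j) r :=
    isHomogeneousInt_natCast_iff.mpr (hρ.homogeneous j i)
  have hgr (v) (hv : v ∈ LinearMap.ker A.mulVecLin) (k : ℕ) :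
      shiftComponent 0 k v ∈ LinearMap.ker A.mulVecLin := by
    -- All columns of `A` have the same degree, so the source can be left unshifted and the target
    -- shifted by r instead.
    have hA : IsGradedMatrix 0 (fun _ => -(r : ℤ)) A := fun i j => by
      simpa using hAhom i j
    rw [LinearMap.mem_ker] at hv ⊢
    rw [hA.mulVec_shiftComponent, hv, map_zero]
  obtain ⟨n, ε, g, hg, hinj⟩ := exists_homogeneous_basis hgr (hasRegularVariables_ker hexA)
  let σ := Tuple.sort ε
  let B : Matrix (Fin m) (Fin n) S := Matrix.of fun i j => g (σ j) i
  have hBv (w : Fin n → S) : B.mulVecLin w = Fintype.linearCombination S g (w ∘ σ.symm) := by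
    rw [Matrix.mulVecLin_apply, Matrix.mulVec_eq_sum, Fintype.linearCombination_apply,
      ← Equiv.sum_comp σ fun j => (w ∘ σ.symm) j • g j]
    refine Finset.sum_congr rfl fun j _ => ?_
    rw [op_smul_eq_smul, Function.comp_apply, Equiv.symm_apply_apply]
    rfl
  have hBr : LinearMap.range B.mulVecLin = LinearMap.ker A.mulVecLin := by
    rw [← hg.span_eq, ← Fintype.range_linearCombination]
    ext v
    constructor
    · rintro ⟨w, rfl⟩
      exact ⟨_, (hBv w).symm⟩
    · rintro ⟨w, rfl⟩
      exact ⟨w ∘ σ, by rw [hBv, Function.comp_assoc, Equiv.self_comp_symm, Function.comp_id]⟩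
  have hexB : Function.Exact B.mulVecLin A.mulVecLin := LinearMap.exact_iff.mpr hBr.symm
  refine ⟨n, fun j => d - 1 + r + ε (σ j), A, B, ?_⟩
  refine
    { monotone_δ := monotone_const
      monotone_e := fun i j hij => by
        have := Tuple.monotone_sort ε hij
        simp only [Function.comp_apply] at this
        simp only [σ]
        omega
      graded_A := fun i j => by simpa using hAhom i j
      graded_B := fun i j => by
        rw [add_sub_cancel_left]
        exact hg.homogeneous (σ j) i
      exact_gradient := hexA
      exact_A := hexB
      injective_B := fun v w hvw => ?_
      minimal_A := fun i j => ?_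
      minimal_B := fun i j => ?_ }
  · rw [hBv, hBv] at hvw
    exact σ.symm.surjective.injective_comp_right (hinj hvw)
  · by_contra hc
    have := hAhom i j 0 hc
    rw [map_zero] at this
    omega
  · by_contra hc
    -- Column `j` of `B` is a relation among the `ρ`; a constant term in it would be a unit
    -- coefficient and make a generator redundant.
    have h1 := hexB.apply_apply_eq_zero (Pi.single j 1)
    rw [hAv] at h1
    refine hρ.irredundant i (mem_span_of_relation h1 hc ?_)
    rw [Matrix.mulVecLin_apply, Matrix.mulVec_single_one]
    exact (hg.homogeneous (σ j) i).eq_C_of_constantCoeff_ne_zero hc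

/-- Were a partial zero, a unit vector would be a syzygy, but generators of positive degree span
only vectors without constant terms. -/
theorem pderiv_ne_zero_of_generators {f : S} {m r : ℕ} (hr : 1 ≤ r)
    {ρ : Fin m → Fin 3 → S} (hρ : IsMinimalGenerators f (fun _ => r) ρ) (i : Fin 3) :
    MvPolynomial.pderiv i f ≠ 0 := by
  intro h
  have h1 : (Pi.single i 1 : Fin 3 → S) ∈ D0 f := by
    rw [D0, LinearMap.mem_ker, gradientMap_apply]
    simp [Pi.single_apply, h]
  rw [← hρ.span_eq, Submodule.mem_span_range_iff_exists_fun] at h1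
  obtain ⟨c, hc⟩ := h1
  have h2 := congrArg MvPolynomial.constantCoeff (congrFun hc i)
  have h3 (j : Fin m) : MvPolynomial.constantCoeff (ρ j i) = 0 := by
    by_contra hne
    have := (isHomogeneousInt_natCast_iff.mpr (hρ.homogeneous j i)) 0 hne
    rw [map_zero] at this
    omega
  simp [Finset.sum_apply, h3] at h2

/-- Injectivity makes column `j` of `B` nonzero, and by minimality its nonzero entries, of degree
ε_j, have no constant term. -/
theorem epsilon_pos {f : S} {d m r : ℕ} {e : Fin (m - 2) → ℤ} {A : Matrix (Fin 3) (Fin m) S}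
    {B : Matrix (Fin m) (Fin (m - 2)) S}
    (h : IsMinimalResolution f d (fun _ : Fin m => r) e A B) (j : Fin (m - 2)) :
    1 ≤ epsilon d (fun _ : Fin m => r) e j := by
  have h1 : B.mulVecLin (Pi.single j 1) ≠ 0 := fun h0 => by
    have := congrFun (h.injective_B (h0.trans (map_zero _).symm)) j
    simp at this
  obtain ⟨i, hi⟩ := Function.ne_iff.mp h1
  rw [Matrix.mulVecLin_apply, Matrix.mulVec_single_one] at hi
  obtain ⟨u, hu⟩ := MvPolynomial.ne_zero_iff.mp hi
  have h2 := h.graded_B i j u hu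
  have h3 : u ≠ 0 := by
    rintro rfl
    exact hu (h.minimal_B i j)
  have h4 : u.degree ≠ 0 := fun h0 => h3 ((Finsupp.degree_eq_zero_iff u).mp h0)
  simp only [epsilon]
  simp only at h2
  omega

/-! ### Partitions of three and the conclusion -/

theorem eq_zero_of_sum_eq_zero {N : ℕ} {x : Fin N → ℤ} (h0 : ∀ j, 0 ≤ x j) (hs : ∑ j, x j = 0) :
    x = 0 :=
  funext fun j => (Finset.sum_eq_zero_iff_of_nonneg fun j _ => h0 j).mp hs j (Finset.mem_univ j)

theorem last_pos_of_sum_pos {N : ℕ} {x : Fin (N + 1) → ℤ} (hx : Monotone x)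
    (hs : 0 < ∑ j, x j) : 1 ≤ x (Fin.last N) := by
  by_contra! h
  exact absurd (Finset.sum_nonpos fun j _ => (hx (Fin.le_last j)).trans (by omega))
    (not_le.mpr hs)

/-- The partitions of three. -/
theorem monotone_sum_eq_three {N : ℕ} {x : Fin N → ℤ} (hx : Monotone x) (h0 : ∀ j, 0 ≤ x j)
    (hs : ∑ j, x j = 3) :
    ((∀ j, x j = if j.val + 1 = N then 3 else 0) ∧ ∑ j, x j ^ 2 = 9) ∨
    ((∀ j, x j = if j.val + 1 = N then 2 else if j.val + 2 = N then 1 else 0) ∧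
      ∑ j, x j ^ 2 = 5) ∨
    (3 ≤ N ∧ (∀ j, x j = if N ≤ j.val + 3 then 1 else 0) ∧ ∑ j, x j ^ 2 = 3) := by
  obtain _ | N := N
  · simp at hs
  have hm1 : Monotone fun j : Fin N => x j.castSucc := fun i j hij => hx (by simpa using hij)
  have l1 := last_pos_of_sum_pos hx (by omega)
  rw [Fin.sum_univ_castSucc] at hs
  have p1 : 0 ≤ ∑ j : Fin N, x j.castSucc := Finset.sum_nonneg fun j _ => h0 _
  rw [Fin.sum_univ_castSucc]
  by_cases c1 : ∑ j : Fin N, x j.castSucc = 0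
  · have z := eq_zero_of_sum_eq_zero (fun _ => h0 _) c1
    have z' (j : Fin N) : x j.castSucc = 0 := congrFun z j
    have hl : x (Fin.last N) = 3 := by omega
    refine Or.inl ⟨fun j => ?_, by simp [z', hl]⟩
    refine Fin.lastCases ?_ (fun i => ?_) j
    · simp [hl]
    · rw [z', if_neg]
      simp
      omega
  obtain _ | N := N
  · simp at c1
  have hm2 : Monotone fun j : Fin N => x j.castSucc.castSucc := fun i j hij => hx (by simpa using hij)
  have l2 := last_pos_of_sum_pos hm1 (by omega)
  rw [Fin.sum_univ_castSucc] at hs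
  have p2 : 0 ≤ ∑ j : Fin N, x j.castSucc.castSucc := Finset.sum_nonneg fun j _ => h0 _
  have le12 := hx (Fin.le_last (Fin.last N).castSucc)
  rw [Fin.sum_univ_castSucc]
  by_cases c2 : ∑ j : Fin N, x j.castSucc.castSucc = 0
  · have z := eq_zero_of_sum_eq_zero (fun _ => h0 _) c2
    have z' (j : Fin N) : x j.castSucc.castSucc = 0 := congrFun z j
    have hl : x (Fin.last (N + 1)) = 2 := by omega
    have hl2 : x (Fin.last N).castSucc = 1 := by omega
    refine Or.inr (Or.inl ⟨fun j => ?_, by simp [z', hl, hl2]⟩)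
    refine Fin.lastCases ?_ (fun i => Fin.lastCases ?_ (fun i => ?_) i) j
    · simp [hl]
    · simp [hl2]
    · rw [z', if_neg, if_neg] <;> simp <;> omega
  obtain _ | N := N
  · simp at c2
  have l3 := last_pos_of_sum_pos hm2 (by omega)
  rw [Fin.sum_univ_castSucc] at hs
  have p3 : 0 ≤ ∑ j : Fin N, x j.castSucc.castSucc.castSucc := Finset.sum_nonneg fun j _ => h0 _
  have z := eq_zero_of_sum_eq_zero (x := fun j : Fin N => x j.castSucc.castSucc.castSucc)
    (fun _ => h0 _) (by omega)
  have z' (j : Fin N) : x j.castSucc.castSucc.castSucc = 0 := congrFun z j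
  have hl : x (Fin.last (N + 1 + 1)) = 1 := by omega
  have hl2 : x (Fin.last (N + 1)).castSucc = 1 := by omega
  have hl3 : x (Fin.last N).castSucc.castSucc = 1 := by omega
  rw [Fin.sum_univ_castSucc]
  refine Or.inr (Or.inr ⟨by omega, fun j => ?_, by simp [z', hl, hl2, hl3]⟩)
  refine Fin.lastCases ?_ (fun i => Fin.lastCases ?_
    (fun i => Fin.lastCases ?_ (fun i => ?_) i) i) j
  · simp [hl]
  · simp [hl2]
  · simp [hl3]
  · rw [z', if_neg]
    simp

end JacobianSyzygies

open JacobianSyzygies in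
theorem mainTheorem5 (f : S) (d r m : ℕ) (hC : IsCurveOfType f d r m) (hm : 3 < m)
    (hΔ : deltaM d r m = 3) :
    ∃ τ : ℕ, IsTotalTjurina f τ ∧
      (∃ (e : Fin (m - 2) → ℤ) (A : Matrix (Fin 3) (Fin m) S) (B : Matrix (Fin m) (Fin (m - 2)) S),
        IsMinimalResolution f d (fun _ : Fin m => r) e A B) ∧
      ∀ (e : Fin (m - 2) → ℤ) (A : Matrix (Fin 3) (Fin m) S) (B : Matrix (Fin m) (Fin (m - 2)) S),
        IsMinimalResolution f d (fun _ : Fin m => r) e A B →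
        -- `ε_{m-2} = 4` and `ε_j = 1` for `j ≤ m - 3`
        ((∀ j : Fin (m - 2), epsilon d (fun _ : Fin m => r) e j =
              if j.val + 1 = m - 2 then 4 else 1) ∧
            (τ : ℚ) = (d : ℚ) * (d - 1) / 2 - 6 + r * ((d : ℚ) - r - 2)) ∨
        -- `ε_{m-2} = 3`, `ε_{m-3} = 2` and `ε_j = 1` for `j ≤ m - 4`
        ((∀ j : Fin (m - 2), epsilon d (fun _ : Fin m => r) e j =
              if j.val + 1 = m - 2 then 3 else if j.val + 1 = m - 3 then 2 else 1) ∧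
            (τ : ℚ) = (d : ℚ) * (d - 1) / 2 - 4 + r * ((d : ℚ) - r - 2)) ∨
        -- `m ≥ 5`, `ε_{m-2} = ε_{m-3} = ε_{m-4} = 2` and `ε_j = 1` for `j ≤ m - 5`
        (5 ≤ m ∧
          (∀ j : Fin (m - 2), epsilon d (fun _ : Fin m => r) e j =
              if m - 4 ≤ j.val + 1 then 2 else 1) ∧
            (τ : ℚ) = (d : ℚ) * (d - 1) / 2 - 3 + r * ((d : ℚ) - r - 2)) := by
  obtain ⟨hd3, hf, hsq, ρ, hρ⟩ := hC
  have hd : 1 ≤ d := by omega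
  have hmr : (m : ℤ) = 2 * r - d := by
    unfold deltaM at hΔ
    omega
  have hr : 1 ≤ r := by omega
  have h0 := pderiv_ne_zero_of_generators hr hρ 0
  obtain ⟨n, e₀, A₀, B₀, hres⟩ := exists_minimalResolution (d := d) hr hρ
  obtain ⟨hn, -, hev⟩ := resolution_numerics hd hf hsq h0 hres
  obtain rfl : n = m - 2 := by omega
  obtain ⟨k₀, hk₀⟩ := eventually_atTop.mp hev
  have hτ : IsTotalTjurina f (milnorDim f k₀) := by
    refine eventually_atTop.mpr ⟨k₀, fun k hk => ?_⟩
    exact_mod_cast (hk₀ k hk).trans (hk₀ k₀ le_rfl).symm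
  refine ⟨milnorDim f k₀, hτ, ⟨e₀, A₀, B₀, hres⟩, fun e A B h => ?_⟩
  obtain ⟨-, hsum, hev'⟩ := resolution_numerics hd hf hsq h0 h
  -- τ was fixed by one resolution; comparison in a common large degree gives its formula in terms
  -- of an arbitrary one.
  obtain ⟨k, hk1, hk2⟩ := (hτ.and hev').exists
  rw [hk1] at hk2
  generalize milnorDim f k₀ = τ at hk2
  set x : Fin (m - 2) → ℤ := fun j => epsilon d (fun _ : Fin m => r) e j - 1 with hx
  have hε (j : Fin (m - 2)) : epsilon d (fun _ : Fin m => r) e j = x j + 1 := by simp [hx]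
  have hex (j : Fin (m - 2)) : e j = x j + (d + r) := by
    simp only [hx, epsilon]
    ring
  have hm2 : ((m - 2 : ℕ) : ℤ) = m - 2 := by omega
  -- After substituting e_j = x_j + d + r, the sum formula reads Σ x_j = 2r - d + 3 - m.
  have hxs : ∑ j, x j = 3 := by
    simp only [hex, Finset.sum_add_distrib, Finset.sum_const, Finset.card_univ, Fintype.card_fin,
      nsmul_eq_mul, hm2] at hsum
    linear_combination hsum - hmr
  have hsq2 : ∑ j, (e j : ℚ) ^ 2 = (∑ j, x j ^ 2 : ℤ) + 6 * (d + r) + (m - 2) * (d + r) ^ 2 := by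
    have h1 (j : Fin (m - 2)) : e j ^ 2 = x j ^ 2 + 2 * (d + r) * x j + (d + r) ^ 2 := by
      rw [hex]
      ring
    have h2 : ∑ j, e j ^ 2 = ∑ j, x j ^ 2 + 6 * (d + r) + (m - 2) * (d + r) ^ 2 := by
      simp only [h1, Finset.sum_add_distrib, ← Finset.mul_sum, hxs, Finset.sum_const,
        Finset.card_univ, Fintype.card_fin, nsmul_eq_mul, hm2]
      ring
    exact_mod_cast h2
  rw [hsq2] at hk2
  have hmq : (m : ℚ) = 2 * r - d := by exact_mod_cast hmr
  rw [hmq] at hk2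
  have hxm : Monotone x := fun i j hij => by
    have := h.monotone_e hij
    rw [hex, hex] at this
    omega
  rcases monotone_sum_eq_three hxm (fun j => by have := epsilon_pos h j; simp only [hx]; omega) hxs
    with ⟨h1, h2⟩ | ⟨h1, h2⟩ | ⟨hN, h1, h2⟩
  · refine Or.inl ⟨fun j => ?_, ?_⟩
    · rw [hε, h1]
      split_ifs <;> rfl
    · rw [hk2, h2]
      push_cast
      ring
  · refine Or.inr (Or.inl ⟨fun j => ?_, ?_⟩)
    · rw [hε, h1]
      split_ifs <;> omega
    · rw [hk2, h2]
      push_cast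
      ring
  · refine Or.inr (Or.inr ⟨by omega, fun j => ?_, ?_⟩)
    · rw [hε, h1]
      split_ifs <;> omega
    · rw [hk2, h2]
      push_cast
      ring
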